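/- Let $\Omega$ be a compact Hausdorff space with topology $\tau$, let $H$ be a complex Hilbert space, let $B(H)$ be the algebra of bounded linear operators on $H$ and $K(H)$ the C$^*$-algebra of compact ones, and let $C(\Omega,K(H))$ be the C$^*$-algebra of all norm-continuous functions $\Omega\to K(H)$ with pointwise operations. Let $D:C(\Omega,K(H))\to C(\Omega,K(H))$ be a derivation, i.e. a linear map (no continuity is assumed) with $D(XY)=D(X)Y+XD(Y)$ for all $X,Y\in C(\Omega,K(H))$. Then there exists a bounded mapping $Z_0:\Omega\to B(H)$, continuous from $\tau$ to the weak$^*$ topology of $B(H)$ (as the dual of its predual $B(H)_*$), such that $$D(X)(t)=[Z_0(t),X(t)]=Z_0(t)X(t)-X(t)Z_0(t)\qquad\text{for every } X\in C(\Omega,K(H)) \text{ and } t\in\Omega .$$ In particular, for every $t\in\Omega$, $$\delta_t D\,\Gamma\,\delta_t(A)=\delta_t D(A)\qquad\text{for every } A\in C(\Omega,K(H)),$$ where $\delta_t:C(\Omega,K(H))\to K(H)$ is the evaluation $X\mapsto X(t)$ and $\Gamma:K(H)\to C(\Omega,K(H))$ sends $a$ to the constant function with value $a$. -/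

import Mathlib

open Topology

set_option maxSynthPendingDepth 3

noncomputable section

/-- A derivation on a (complex, not necessarily unital) algebra `A`: a linear map `D : A → A`
with `D (a b) = D(a) b + a D(b)`. -/
def IsDerivation {A : Type*} [NonUnitalRing A] [Module ℂ A] (D : A →ₗ[ℂ] A) : Prop :=
  ∀ a b : A, D (a * b) = D a * b + a * D b

section Evaluation

variable {Ω A : Type*} [TopologicalSpace Ω] [NonUnitalRing A] [TopologicalSpace A]
  [IsTopologicalRing A] [Module ℂ A] [ContinuousConstSMul ℂ A]

/-- The evaluation homomorphism `δ_t : C(Ω, A) → A`, `X ↦ X(t)`. -/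
def evalHom (t : Ω) : C(Ω, A) →ₙₐ[ℂ] A where
  toFun X := X t
  map_smul' _ _ := rfl
  map_zero' := rfl
  map_add' _ _ := rfl
  map_mul' _ _ := rfl

/-- The homomorphism `Γ : A → C(Ω, A)` sending `a` to the constant function `t ↦ a`. -/
def constHom (Ω : Type*) [TopologicalSpace Ω] : A →ₙₐ[ℂ] C(Ω, A) where
  toFun a := ContinuousMap.const Ω a
  map_smul' _ _ := rfl
  map_zero' := rfl
  map_add' _ _ := rfl
  map_mul' _ _ := rfl

end Evaluation

section Operators

variable (H : Type*) [NormedAddCommGroup H] [InnerProductSpace ℂ H]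

/-- The algebra `K(H)` of compact operators on `H`, with the operator norm of `B(H)`. -/
def compactOperators : NonUnitalSubalgebra ℂ (H →L[ℂ] H) where
  carrier := {T | IsCompactOperator T}
  add_mem' hS hT := hS.add hT
  zero_mem' := isCompactOperator_zero
  mul_mem' {S _} _ hT := hT.clm_comp S
  smul_mem' c _ hT := hT.smul c

variable {H} in
/-- The vector functional `T ↦ ⟪ξ, T η⟫` on `B(H)`. -/
def vectorFunctional (ξ η : H) : StrongDual ℂ (H →L[ℂ] H) :=
  (innerSL ℂ ξ).comp (ContinuousLinearMap.apply ℂ H η)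

/-- The predual `B(H)_*` of `B(H)`: the norm closure, in the Banach dual of `B(H)`, of the linear
span of the vector functionals. (These are the normal functionals `T ↦ tr(ρT)`, with `ρ` of trace
class.) -/
def predual : Submodule ℂ (StrongDual ℂ (H →L[ℂ] H)) :=
  (Submodule.span ℂ {φ | ∃ ξ η : H, φ = vectorFunctional ξ η}).topologicalClosure

/-- The canonical map `B(H) → (B(H)_*)^*`, `T ↦ (φ ↦ φ T)`. -/
def toPredualDual : (H →L[ℂ] H) →ₗ[ℂ] StrongDual ℂ (predual H) where
  toFun T := (ContinuousLinearMap.apply ℂ ℂ T).comp (predual H).subtypeL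
  map_add' _ _ := by ext φ; simp
  map_smul' _ _ := by ext φ; simp

/-- The weak* topology of `B(H)`, as the dual of `B(H)_*`: the coarsest topology making all
`T ↦ φ T`, `φ ∈ B(H)_*`, continuous. -/
@[reducible] def weakStarTopology : TopologicalSpace (H →L[ℂ] H) :=
  TopologicalSpace.induced (fun T => StrongDual.toWeakDual (toPredualDual H T)) inferInstance

variable {H} in
theorem vectorFunctional_mem_predual (ξ η : H) : vectorFunctional ξ η ∈ predual H :=
  Submodule.le_topologicalClosure _ (Submodule.subset_span ⟨ξ, η, rfl⟩)

variable {H} in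
theorem norm_vectorFunctional_le (ξ η : H) : ‖vectorFunctional ξ η‖ ≤ ‖ξ‖ * ‖η‖ := by
  refine ContinuousLinearMap.opNorm_le_bound _ (by positivity) fun T => ?_
  calc ‖inner ℂ ξ (T η)‖ ≤ ‖ξ‖ * ‖T η‖ := norm_inner_le_norm _ _
    _ ≤ ‖ξ‖ * (‖T‖ * ‖η‖) := by gcongr; exact T.le_opNorm η
    _ = ‖ξ‖ * ‖η‖ * ‖T‖ := by ring

/-- The canonical map `B(H) → (B(H)_*)^*` is isometric, ... -/
theorem norm_toPredualDual (T : H →L[ℂ] H) : ‖toPredualDual H T‖ = ‖T‖ := by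
  apply le_antisymm
  · refine ContinuousLinearMap.opNorm_le_bound _ (norm_nonneg _) fun φ => ?_
    rw [mul_comm]
    exact φ.1.le_opNorm T
  · refine T.opNorm_le_bound (ContinuousLinearMap.opNorm_nonneg _) fun η => ?_
    by_cases h : T η = 0
    · rw [h, norm_zero]; positivity
    have h1 := (toPredualDual H T).le_opNorm
      ⟨vectorFunctional (T η) η, vectorFunctional_mem_predual _ _⟩
    have h2 : ‖toPredualDual H T ⟨vectorFunctional (T η) η, vectorFunctional_mem_predual _ _⟩‖
        = ‖T η‖ * ‖T η‖ := by
      change ‖inner ℂ (T η) (T η)‖ = _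
      rw [inner_self_eq_norm_sq_to_K]
      simp [sq]
    rw [h2] at h1
    have h3 : ‖T η‖ * ‖T η‖ ≤ ‖toPredualDual H T‖ * (‖T η‖ * ‖η‖) :=
      h1.trans (mul_le_mul_of_nonneg_left (norm_vectorFunctional_le _ _) (ContinuousLinearMap.opNorm_nonneg _))
    have h4 : 0 < ‖T η‖ := norm_pos_iff.mpr h
    nlinarith

/-- ... and onto, so that `B(H)` is the Banach dual of `B(H)_*`. -/
theorem toPredualDual_surjective [CompleteSpace H] :
    Function.Surjective (toPredualDual H) := by
  intro ψ
  let B : H →L⋆[ℂ] H →L[ℂ] ℂ := LinearMap.mkContinuous₂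
    (LinearMap.mk₂'ₛₗ (starRingEnd ℂ) (RingHom.id ℂ)
      (fun ξ η => ψ ⟨vectorFunctional ξ η, vectorFunctional_mem_predual ξ η⟩)
      (fun a b c => by
        rw [← map_add]; congr 1; ext T
        exact inner_add_left a b (T c))
      (fun r a b => by
        rw [← map_smul]; congr 1; ext T
        exact inner_smul_left a (T b) r)
      (fun a b c => by
        rw [← map_add]; congr 1; ext T
        change inner ℂ a (T (b + c)) = inner ℂ a (T b) + inner ℂ a (T c)
        rw [map_add, inner_add_right])
      (fun r a b => by
        rw [← map_smul]; congr 1; ext T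
        change inner ℂ a (T (r • b)) = r • inner ℂ a (T b)
        rw [map_smul, inner_smul_right, smul_eq_mul])) ‖ψ‖
    (fun ξ η => by
      rw [mul_assoc]
      exact (ψ.le_opNorm _).trans
        (mul_le_mul_of_nonneg_left (norm_vectorFunctional_le ξ η) (norm_nonneg _)))
  let S : H →L[ℂ] H := InnerProductSpace.continuousLinearMapOfBilin B
  let T : H →L[ℂ] H := ContinuousLinearMap.adjoint S
  have key : ∀ ξ η : H, inner ℂ ξ (T η)
      = ψ ⟨vectorFunctional ξ η, vectorFunctional_mem_predual ξ η⟩ := by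
    intro ξ η
    rw [ContinuousLinearMap.adjoint_inner_right]
    exact InnerProductSpace.continuousLinearMapOfBilin_apply B ξ η
  refine ⟨T, ?_⟩
  have hsub : ∀ φ (hφ : φ ∈ Submodule.span ℂ {φ | ∃ ξ η : H, φ = vectorFunctional ξ η}),
      φ T = ψ ⟨φ, Submodule.le_topologicalClosure _ hφ⟩ := by
    intro φ hφ
    induction hφ using Submodule.span_induction with
    | mem x hx => obtain ⟨ξ, η, rfl⟩ := hx; exact key ξ η
    | zero => exact (map_zero ψ).symm
    | add x y hx hy h1 h2 =>
      rw [add_apply, h1, h2, ← map_add]; rfl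
    | smul c x hx h1 => rw [smul_apply, h1, ← map_smul]; rfl
  ext φ
  obtain ⟨φ, hφ⟩ := φ
  obtain ⟨u, hu, hlim⟩ := mem_closure_iff_seq_limit.mp hφ
  have e1 : Filter.Tendsto (fun n => u n T) Filter.atTop (𝓝 (φ T)) :=
    ((ContinuousLinearMap.apply ℂ ℂ T).continuous.tendsto φ).comp hlim
  have e2 : Filter.Tendsto (fun n => ψ ⟨u n, Submodule.le_topologicalClosure _ (hu n)⟩)
      Filter.atTop (𝓝 (ψ ⟨φ, hφ⟩)) :=
    (ψ.continuous.tendsto _).comp (tendsto_subtype_rng.mpr hlim)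
  exact tendsto_nhds_unique e1 (e2.congr fun n => (hsub _ (hu n)).symm)

end Operators

end

/-!
Evaluating at a point turns the problem into one about derivations of `K(H)`, and for those the
implementing operator can be written down explicitly. No general automatic continuity theorem is
needed: rank-one operators do all the work. Write `|ξ⟩⟨η|` for the operator `x ↦ ⟪η, x⟫ ξ`.

*Locality.* If `X t = 0` then `D X t = 0`. For a function `f • |u⟩⟨u|` with `f` scalar and `f t = 0`,
factor `f = g h` with `g t = h t = 0` and apply the Leibniz rule. For general `X`, the function
`|u⟩⟨a| X |b⟩⟨u| = ⟪a, X b⟫ • |u⟩⟨u|` is of this form, and the Leibniz rule shows that the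
derivative of this triple product at `t` is `|u⟩⟨a| (D X t) |b⟩⟨u|`; so all matrix coefficients of
`D X t` vanish (`IsDerivation.apply_eq_zero_of_apply_eq_zero`). Hence `D X t` depends only on `X t`,
and `a ↦ D (Γ a) t` is a derivation `d` of `K(H)` with `d (X t) = D X t`.

*Derivations of `K(H)`.* For a unit vector `u` put `Z ξ = d(|ξ⟩⟨u|) u`. Applying the Leibniz rule to
`a |ξ⟩⟨u| = |a ξ⟩⟨u|` gives `d a = Z a - a Z`. Taking `a = |u⟩⟨η|` shows that `x ↦ ⟪η, Z x⟫` is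
continuous for each `η`, so `Z` is bounded by the closed graph theorem
(`IsDerivation.exists_eq_commutator`).

*Dependence on the point.* With `u` fixed, `Z₀ t ξ = D (Γ |ξ⟩⟨u|) t u` is norm continuous in `t`. So
`Z₀` is continuous for the strong operator topology, it is bounded by compactness of `Ω` and the
Banach–Steinhaus theorem, and a bounded function that is continuous against all vector functionals
is weak* continuous, because the vector functionals span a norm dense subspace of the predual
(`continuous_weakStarTopology_of_bounded`).
-/

open InnerProductSpace

noncomputable section

variable {Ω H : Type*} [TopologicalSpace Ω] [NormedAddCommGroup H] [InnerProductSpace ℂ H]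

/-! ### Rank-one operators -/

theorem isCompactOperator_rankOne (ξ η : H) : IsCompactOperator (rankOne ℂ ξ η) := by
  refine ⟨(fun z : ℂ => z • ξ) '' Metric.closedBall 0 1,
    (isCompact_closedBall (0 : ℂ) 1).image (by fun_prop), ?_⟩
  have h : (innerSL ℂ η) ⁻¹' Metric.closedBall 0 1 ∈ 𝓝 (0 : H) :=
    (innerSL ℂ η).continuous.continuousAt.preimage_mem_nhds
      (by rw [map_zero]; exact Metric.closedBall_mem_nhds _ one_pos)
  filter_upwards [h] with x hx
  exact ⟨inner ℂ η x, hx, rfl⟩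

/-- The rank-one operator `x ↦ ⟪η, x⟫ ξ` as an element of `K(H)`. -/
def compactRankOne (ξ η : H) : compactOperators H :=
  ⟨rankOne ℂ ξ η, isCompactOperator_rankOne ξ η⟩

theorem coe_compactRankOne_apply (ξ η x : H) :
    (compactRankOne ξ η : H →L[ℂ] H) x = inner ℂ η x • ξ := rfl

theorem mul_compactRankOne (a : compactOperators H) (ξ η : H) :
    a * compactRankOne ξ η = compactRankOne ((a : H →L[ℂ] H) ξ) η := by
  ext x
  change (a : H →L[ℂ] H) (inner ℂ η x • ξ) = inner ℂ η x • (a : H →L[ℂ] H) ξ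
  exact map_smul _ _ _

theorem compactRankOne_mul_mul (u a b : H) (x : compactOperators H) :
    compactRankOne u a * x * compactRankOne b u
      = inner ℂ a ((x : H →L[ℂ] H) b) • compactRankOne u u := by
  ext y
  change inner ℂ a ((x : H →L[ℂ] H) (inner ℂ u y • b)) • u
    = inner ℂ a ((x : H →L[ℂ] H) b) • inner ℂ u y • u
  rw [map_smul, inner_smul_right, mul_comm, mul_smul]

/-- Left multiplication by `|u⟩⟨a|` and right multiplication by `|b⟩⟨u|` extract the matrix
coefficient of `x` at `a, b`, so together they separate the points of `K(H)`. -/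
theorem eq_zero_of_compactRankOne_mul_mul_eq_zero {u : H} (hu : u ≠ 0) {x : compactOperators H}
    (h : ∀ a b, compactRankOne u a * x * compactRankOne b u = 0) : x = 0 := by
  ext b
  refine ext_inner_left ℂ fun a => ?_
  have h1 := congrArg (fun y : compactOperators H => (y : H →L[ℂ] H) u) (h a b)
  rw [compactRankOne_mul_mul] at h1
  change inner ℂ a ((x : H →L[ℂ] H) b) • inner ℂ u u • u = 0 at h1
  change inner ℂ a ((x : H →L[ℂ] H) b) = inner ℂ a (0 : H)
  rw [inner_zero_right]
  simpa [hu] using h1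

theorem compactRankOne_add_left (ξ ξ' η : H) :
    compactRankOne (ξ + ξ') η = compactRankOne ξ η + compactRankOne ξ' η := by
  ext x
  exact smul_add _ _ _

theorem compactRankOne_smul_left (c : ℂ) (ξ η : H) :
    compactRankOne (c • ξ) η = c • compactRankOne ξ η := by
  ext x
  exact smul_comm _ _ _

/-! ### Locality of derivations of `C(Ω, K(H))` -/

/-- A scalar function vanishing at `t` is a product of two such functions, one of them `√‖f‖`. -/
theorem ContinuousMap.exists_mul_eq_of_apply_eq_zero (f : C(Ω, ℂ)) {t : Ω} (ht : f t = 0) :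
    ∃ g h : C(Ω, ℂ), g * h = f ∧ g t = 0 ∧ h t = 0 := by
  have hsq : ∀ s, Real.sqrt ‖f s‖ * Real.sqrt ‖f s‖ = ‖f s‖ := fun s =>
    Real.mul_self_sqrt (norm_nonneg _)
  -- At the zeros of `f` the quotient `f / √‖f‖` takes the junk value `0 / 0 = 0`, which is the
  -- continuous extension, since its norm is `√‖f‖` everywhere.
  have hnorm : ∀ s, ‖f s / (Real.sqrt ‖f s‖ : ℂ)‖ = Real.sqrt ‖f s‖ := by
    intro s
    rw [norm_div, Complex.norm_real, Real.norm_of_nonneg (Real.sqrt_nonneg _), Real.div_sqrt]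
  refine ⟨⟨fun s => (Real.sqrt ‖f s‖ : ℂ), by fun_prop⟩,
    ⟨fun s => f s / (Real.sqrt ‖f s‖ : ℂ), ?_⟩, ?_, ?_, ?_⟩
  · refine continuous_iff_continuousAt.2 fun s => ?_
    by_cases hs : f s = 0
    · rw [ContinuousAt, hs, zero_div]
      refine squeeze_zero_norm (fun s' => (hnorm s').le) ?_
      have : Continuous fun s' => Real.sqrt ‖f s'‖ := by fun_prop
      simpa [hs] using this.tendsto s
    · refine ContinuousAt.div (by fun_prop) (by fun_prop) ?_
      simpa [Real.sqrt_eq_zero'] using hs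
  · ext s
    by_cases hs : f s = 0
    · simp [hs]
    · refine mul_div_cancel₀ (f s) ?_
      simpa [Real.sqrt_eq_zero'] using hs
  · simp [ht]
  · simp [ht]

namespace IsDerivation

variable {D : C(Ω, compactOperators H) →ₗ[ℂ] C(Ω, compactOperators H)}

theorem smul_const_apply_eq_zero (hD : IsDerivation D) {p : compactOperators H} (hp : p * p = p)
    {f : C(Ω, ℂ)} {t : Ω} (hf : f t = 0) : D (f • constHom Ω p) t = 0 := by
  obtain ⟨g, h, rfl, hg, hh⟩ := f.exists_mul_eq_of_apply_eq_zero hf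
  have e : (g * h) • constHom Ω p = (g • constHom Ω p) * (h • constHom Ω p) := by
    ext1 s
    change (g s * h s) • p = (g s • p) * (h s • p)
    rw [smul_mul_smul_comm, hp]
  rw [e, hD]
  change D (g • constHom Ω p) t * (h t • p) + (g t • p) * D (h • constHom Ω p) t = 0
  rw [hg, hh, zero_smul, mul_zero, zero_mul, add_zero]

/-- Derivations of `C(Ω, K(H))` are local: `D X t` depends only on `X t`. -/
theorem apply_eq_zero_of_apply_eq_zero (hD : IsDerivation D) {X : C(Ω, compactOperators H)}
    {t : Ω} (hX : X t = 0) : D X t = 0 := by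
  rcases subsingleton_or_nontrivial H with hH | hH
  · ext x
    exact Subsingleton.elim _ _
  obtain ⟨u, hu⟩ := exists_norm_eq H zero_le_one
  have hu0 : u ≠ 0 := by rintro rfl; simp at hu
  have huu : inner ℂ u u = (1 : ℂ) := by rw [inner_self_eq_norm_sq_to_K, hu]; simp
  refine eq_zero_of_compactRankOne_mul_mul_eq_zero hu0 fun a b => ?_
  have hp : compactRankOne u u * compactRankOne u u = compactRankOne u u := by
    rw [mul_compactRankOne, coe_compactRankOne_apply, huu, one_smul]
  let L : C(Ω, compactOperators H) := constHom Ω (compactRankOne u a)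
  let R : C(Ω, compactOperators H) := constHom Ω (compactRankOne b u)
  let f : C(Ω, ℂ) := ⟨fun s => inner ℂ a ((X s : H →L[ℂ] H) b), by
    have : Continuous fun s => (X s : H →L[ℂ] H) := continuous_subtype_val.comp X.continuous
    fun_prop⟩
  have e : L * X * R = f • constHom Ω (compactRankOne u u) := by
    ext1 s
    exact compactRankOne_mul_mul u a b (X s)
  have hf : f t = 0 := by
    change inner ℂ a ((X t : H →L[ℂ] H) b) = 0
    rw [hX]
    exact inner_zero_right _
  have h0 := smul_const_apply_eq_zero hD hp hf
  rw [← e, hD, hD] at h0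
  change (D L t * X t + compactRankOne u a * D X t) * compactRankOne b u
    + compactRankOne u a * X t * D R t = 0 at h0
  simpa only [hX, mul_zero, zero_mul, zero_add, add_zero] using h0

theorem apply_const_apply (hD : IsDerivation D) (X : C(Ω, compactOperators H)) (t : Ω) :
    D (constHom Ω (X t)) t = D X t := by
  have h : D (constHom Ω (X t) - X) t = 0 :=
    hD.apply_eq_zero_of_apply_eq_zero (sub_self (X t))
  rw [map_sub] at h
  exact sub_eq_zero.1 h

/-! ### Derivations of `K(H)` -/

/-- A derivation `d` of `K(H)` is the commutator with the bounded operator `ξ ↦ d(|ξ⟩⟨u|) u`, where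
`u` is any unit vector. -/
theorem exists_eq_commutator [CompleteSpace H]
    {d : compactOperators H →ₗ[ℂ] compactOperators H} (hd : IsDerivation d)
    {u : H} (hu : ‖u‖ = 1) :
    ∃ Z : H →L[ℂ] H, (∀ ξ, Z ξ = (d (compactRankOne ξ u) : H →L[ℂ] H) u) ∧
      ∀ a : compactOperators H, (d a : H →L[ℂ] H) = Z * (a : H →L[ℂ] H) - (a : H →L[ℂ] H) * Z := by
  have huu : inner ℂ u u = (1 : ℂ) := by rw [inner_self_eq_norm_sq_to_K, hu]; simp
  let Z : H →ₗ[ℂ] H :=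
    { toFun ξ := (d (compactRankOne ξ u) : H →L[ℂ] H) u
      map_add' ξ ξ' := by rw [compactRankOne_add_left, map_add]; rfl
      map_smul' c ξ := by rw [compactRankOne_smul_left, map_smul]; rfl }
  have key : ∀ (a : compactOperators H) (ξ : H),
      (d a : H →L[ℂ] H) ξ = Z ((a : H →L[ℂ] H) ξ) - (a : H →L[ℂ] H) (Z ξ) := by
    intro a ξ
    have h := congrArg (fun y : compactOperators H => (y : H →L[ℂ] H) u)
      (hd a (compactRankOne ξ u))
    rw [mul_compactRankOne] at h
    change Z ((a : H →L[ℂ] H) ξ)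
      = (d a : H →L[ℂ] H) (inner ℂ u u • ξ) + (a : H →L[ℂ] H) (Z ξ) at h
    rw [h, huu, one_smul, add_sub_cancel_right]
  have hinner : ∀ η x, inner ℂ η (Z x)
      = inner ℂ η x * inner ℂ u (Z u) - inner ℂ u ((d (compactRankOne u η) : H →L[ℂ] H) x) := by
    intro η x
    rw [key, coe_compactRankOne_apply, coe_compactRankOne_apply, map_smul, inner_sub_right,
      inner_smul_right, inner_smul_right, huu, mul_one, sub_sub_cancel]
  have hcont : Continuous Z := by
    refine Z.continuous_of_seq_closed_graph fun v x y hv hZv => ?_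
    refine ext_inner_left ℂ fun η => ?_
    have hη : Continuous fun x => inner ℂ η (Z x) := by
      rw [funext (hinner η)]
      fun_prop
    exact tendsto_nhds_unique (Filter.Tendsto.inner tendsto_const_nhds hZv) ((hη.tendsto x).comp hv)
  refine ⟨⟨Z, hcont⟩, fun _ => rfl, fun a => ?_⟩
  ext ξ
  exact key a ξ

end IsDerivation

/-- Evaluating a derivation of `C(Ω, A)` on constant functions at a point gives a derivation
of `A`. -/
theorem IsDerivation.evalHom_comp_constHom {A : Type*} [NonUnitalRing A] [TopologicalSpace A]
    [IsTopologicalRing A] [Module ℂ A] [ContinuousConstSMul ℂ A] {D : C(Ω, A) →ₗ[ℂ] C(Ω, A)}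
    (hD : IsDerivation D) (t : Ω) :
    IsDerivation (((evalHom t : C(Ω, A) →ₙₐ[ℂ] A) : C(Ω, A) →ₗ[ℂ] A) ∘ₗ D ∘ₗ
      ((constHom Ω : A →ₙₐ[ℂ] C(Ω, A)) : A →ₗ[ℂ] C(Ω, A))) := by
  intro a b
  change D (constHom Ω (a * b)) t = D (constHom Ω a) t * b + a * D (constHom Ω b) t
  rw [map_mul, hD]
  rfl

/-! ### Weak* continuity -/

/-- On bounded sets the weak* topology is the weak operator topology. -/
theorem continuous_weakStarTopology_of_bounded {Z : Ω → H →L[ℂ] H} {M : ℝ}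
    (hM : ∀ t, ‖Z t‖ ≤ M) (hZ : ∀ ξ η : H, Continuous fun t => inner ℂ ξ (Z t η)) :
    Continuous[inferInstance, weakStarTopology H] Z := by
  refine continuous_induced_rng.2 (WeakDual.continuous_of_continuous_eval fun φ => ?_)
  obtain ⟨φ, hφ⟩ := φ
  change Continuous fun t => φ (Z t)
  have hspan : ∀ ψ ∈ Submodule.span ℂ {φ | ∃ ξ η : H, φ = vectorFunctional ξ η},
      Continuous fun t => ψ (Z t) := by
    intro ψ hψ
    induction hψ using Submodule.span_induction with
    | mem x hx => obtain ⟨ξ, η, rfl⟩ := hx; exact hZ ξ η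
    | zero => exact continuous_const
    | add x y _ _ h1 h2 => exact h1.add h2
    | smul c x _ h1 => exact h1.const_smul c
  refine continuous_of_uniform_approx_of_continuous fun U hU => ?_
  obtain ⟨ε, hε, hεU⟩ := Metric.mem_uniformity_dist.1 hU
  have hM' : 0 < |M| + 1 := by positivity
  obtain ⟨ψ, hψ, hdist⟩ := Metric.mem_closure_iff.1 hφ (ε / (|M| + 1)) (by positivity)
  refine ⟨fun t => ψ (Z t), hspan ψ hψ, fun t => hεU ?_⟩
  calc dist (φ (Z t)) (ψ (Z t)) = ‖(φ - ψ) (Z t)‖ := dist_eq_norm _ _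
    _ ≤ ‖φ - ψ‖ * ‖Z t‖ := (φ - ψ).le_opNorm _
    _ ≤ ‖φ - ψ‖ * (|M| + 1) := by
      gcongr
      linarith [hM t, le_abs_self M]
    _ < ε / (|M| + 1) * (|M| + 1) := by
      gcongr
      rwa [← dist_eq_norm]
    _ = ε := div_mul_cancel₀ _ hM'.ne'

end

theorem mainTheorem5 {Ω H : Type*} [TopologicalSpace Ω] [CompactSpace Ω] [T2Space Ω]
    [NormedAddCommGroup H] [InnerProductSpace ℂ H] [CompleteSpace H]
    (D : C(Ω, compactOperators H) →ₗ[ℂ] C(Ω, compactOperators H)) (hD : IsDerivation D) :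
    (∃ Z₀ : Ω → H →L[ℂ] H,
      (∃ M : ℝ, ∀ t : Ω, ‖Z₀ t‖ ≤ M) ∧
      Continuous[inferInstance, weakStarTopology H] Z₀ ∧
      ∀ (X : C(Ω, compactOperators H)) (t : Ω),
        (D X t : H →L[ℂ] H) = Z₀ t * (X t : H →L[ℂ] H) - (X t : H →L[ℂ] H) * Z₀ t) ∧
    ∀ (t : Ω) (A : C(Ω, compactOperators H)),
      evalHom (A := compactOperators H) t (D (constHom Ω (evalHom t A)))
        = evalHom (A := compactOperators H) t (D A) := by
  refine ⟨?_, fun t A => hD.apply_const_apply A t⟩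
  rcases subsingleton_or_nontrivial H with hH | hH
  · refine ⟨0, ⟨0, fun t => by simp⟩, @continuous_const _ _ _ (weakStarTopology H) 0, fun X t => ?_⟩
    ext x
    exact Subsingleton.elim _ _
  obtain ⟨u, hu⟩ := exists_norm_eq H zero_le_one
  choose Z hZ hcomm using fun t => (hD.evalHom_comp_constHom t).exists_eq_commutator hu
  have hcont : ∀ ξ, Continuous fun t => Z t ξ := by
    intro ξ
    have h : Continuous fun t => (D (constHom Ω (compactRankOne ξ u)) t : H →L[ℂ] H) :=
      continuous_subtype_val.comp (D _).continuous
    simp only [hZ]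
    exact h.clm_apply continuous_const
  obtain ⟨M, hM⟩ := banach_steinhaus fun ξ => by
    obtain ⟨C, hC⟩ := isCompact_univ.exists_bound_of_continuousOn (hcont ξ).continuousOn
    exact ⟨C, fun t => hC t (Set.mem_univ t)⟩
  refine ⟨Z, ⟨M, hM⟩, continuous_weakStarTopology_of_bounded hM fun ξ η =>
    continuous_const.inner (hcont η), fun X t => ?_⟩
  rw [← hD.apply_const_apply X t]
  exact hcomm t (X t)
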